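/- Let $k$ be an algebraically closed field, let $n>1$ be an odd integer, let $R=k[[x,y]]/(x^n+y^2)$ with maximal ideal $\mathfrak m$ (a one-dimensional Cohen–Macaulay complete local ring), and for an integer $i$ with $1\le i\le n-1$ put $I_i=(x^i,y)R$ and $I=(x)R$. (In particular this covers the ideals $(x,y),(x^2,y),\dots,(x^{(n-1)/2},y)$.) Then $y\in (I_iI:_R I_i)$, $y\notin I$, and $R$ is not $\mathrm{cl}_{I_i}$-rational. Here, for an $R$-module $B$, the module closure $\mathrm{cl}_B$ is the closure operation on $R$-modules given, for $L\subseteq M$, by $$L_M^{\mathrm{cl}_B}=\{u\in M \mid b\otimes u\in \mathrm{im}(B\otimes_R L\to B\otimes_R M)\text{ for all } b\in B\}.$$ For a Cohen–Macaulay complete local ring $(R,\mathfrak m)$ of Krull dimension $d$ with residue field $R/\mathfrak m$, let $E$ be an injective hull of $R/\mathfrak m$ and $\omega=\mathrm{Hom}_R(H^d_{\mathfrak m}(R),E)$ the canonical module. For a closure operation $\mathrm{cl}$ on $R$-modules put $$\tau_{\mathrm{cl}}(\omega)=\mathrm{Ann}_\omega\bigl(0^{\mathrm{cl}}_{H^d_{\mathfrak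 m}(R)}\bigr)=\{f\in\omega \mid f(\eta)=0\text{ for all }\eta\in 0^{\mathrm{cl}}_{H^d_{\mathfrak m}(R)}\};$$ $R$ is called $\mathrm{cl}$-rational if $\tau_{\mathrm{cl}}(\omega)=\omega$. -/

import Mathlib

open scoped TensorProduct

noncomputable section

universe u

/-! ### Closure operations on modules -/

/-- A closure operation on (the category of all) `R`-modules: it assigns to each submodule `N` of
a module `M` a submodule `N_M^cl` of `M`; the assignment is extensive, idempotent and monotone. -/
structure ClosureOperation (R : Type u) [CommRing R] where
  cl : ∀ (M : Type u) [AddCommGroup M] [Module R M], Submodule R M → Submodule R M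
  le_cl : ∀ (M : Type u) [AddCommGroup M] [Module R M] (N : Submodule R M), N ≤ cl M N
  cl_cl : ∀ (M : Type u) [AddCommGroup M] [Module R M] (N : Submodule R M),
    cl M (cl M N) = cl M N
  cl_mono : ∀ (M : Type u) [AddCommGroup M] [Module R M] (N N' : Submodule R M),
    N ≤ N' → cl M N ≤ cl M N'

section ModuleClosure

variable (R : Type u) [CommRing R] (B : Type u) [AddCommGroup B] [Module R B]

/-- The image of `B ⊗ L → B ⊗ M`. -/
def tensorImage (M : Type u) [AddCommGroup M] [Module R M] (L : Submodule R M) :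
    Submodule R (B ⊗[R] M) :=
  LinearMap.range (L.subtype.lTensor B)

/-- `L_M^{cl_B} = {x ∈ M | b ⊗ x ∈ im (B ⊗ L → B ⊗ M) for all b ∈ B}`. -/
def moduleClosureSubmodule (M : Type u) [AddCommGroup M] [Module R M] (L : Submodule R M) :
    Submodule R M where
  carrier := {x | ∀ b : B, b ⊗ₜ[R] x ∈ tensorImage R B M L}
  add_mem' := by
    intro x y hx hy b
    rw [TensorProduct.tmul_add]
    exact add_mem (hx b) (hy b)
  zero_mem' := by
    intro b
    rw [TensorProduct.tmul_zero]
    exact zero_mem _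
  smul_mem' := by
    intro c x hx b
    rw [TensorProduct.tmul_smul]
    exact Submodule.smul_mem _ c (hx b)

/-- The module closure `cl_B` coming from the `R`-module `B`. -/
def moduleClosure : ClosureOperation R where
  cl := moduleClosureSubmodule R B
  le_cl := fun M _ _ N x hx b => ⟨b ⊗ₜ[R] ⟨x, hx⟩, by simp⟩
  cl_cl := by
    intro M _ _ N
    apply le_antisymm
    · intro x hx b
      have key : tensorImage R B M (moduleClosureSubmodule R B M N) ≤ tensorImage R B M N := by
        rintro _ ⟨t, rfl⟩
        induction t with
        | zero => simp
        | tmul c z => simpa using z.2 c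
        | add s t hs ht => simpa using add_mem hs ht
      exact key (hx b)
    · intro x hx b
      exact ⟨b ⊗ₜ[R] ⟨x, hx⟩, by simp⟩
  cl_mono := by
    rintro M _ _ N N' h x hx b
    obtain ⟨t, ht⟩ := hx b
    refine ⟨(Submodule.inclusion h).lTensor B t, ?_⟩
    rw [← ht, ← LinearMap.comp_apply, ← LinearMap.lTensor_comp]
    rfl

end ModuleClosure

/-! ### Injective hulls -/

section InjectiveHull

variable {R : Type u} [CommRing R]

/-- An injective linear map `f : N → E` exhibits `E` as an injective hull of `N` if `E` is an
injective module and every nonzero submodule of `E` meets the image of `N` nontrivially. -/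
structure IsInjectiveHull {N E : Type u} [AddCommGroup N] [Module R N] [AddCommGroup E]
    [Module R E] (f : N →ₗ[R] E) : Prop where
  module_injective : Module.Injective R E
  injective : Function.Injective f
  essential : ∀ S : Submodule R E, S ⊓ LinearMap.range f = ⊥ → S = ⊥

/-- Every module has an injective hull (Eckmann and Schopf). -/
theorem exists_isInjectiveHull (N : Type u) [AddCommGroup N] [Module R N] :
    ∃ (E : ModuleCat.{u} R) (f : N →ₗ[R] E), IsInjectiveHull f := by
  obtain ⟨⟨Q, hQ, i, hi⟩⟩ := CategoryTheory.EnoughInjectives.presentation (ModuleCat.of R N)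
  have hQ' : Module.Injective R Q := Module.injective_module_of_injective_object R Q
  have hinj : Function.Injective i.hom := (ModuleCat.mono_iff_injective i).1 hi
  set K : Submodule R Q := LinearMap.range i.hom with hK
  -- a maximal essential extension `S` of `K` inside `Q`
  obtain ⟨S, hKS, hS⟩ := zorn_le_nonempty₀
    {S : Submodule R Q | K ≤ S ∧ ∀ T ≤ S, T ⊓ K = ⊥ → T = ⊥} (by
      intro c hc hchain y hy
      refine ⟨sSup c, ⟨(hc hy).1.trans (le_sSup hy), ?_⟩, fun z hz => le_sSup hz⟩
      intro T hT hTK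
      rw [Submodule.eq_bot_iff]
      intro x hx
      obtain ⟨Z, hZ, hxZ⟩ := (Submodule.mem_sSup_of_directed ⟨y, hy⟩ hchain.directedOn).1 (hT hx)
      have h1 : T ⊓ Z = ⊥ := (hc hZ).2 _ inf_le_right (by
        rw [inf_right_comm, hTK, bot_inf_eq])
      have h2 : x ∈ T ⊓ Z := ⟨hx, hxZ⟩
      rwa [h1] at h2) K ⟨le_rfl, fun T hT h => by rwa [inf_eq_left.2 hT] at h⟩
  have hess := hS.prop.2
  -- a complement `T` of `S`, maximal among the submodules that meet `S` trivially
  obtain ⟨T, -, hT⟩ := zorn_le_nonempty₀ {T : Submodule R Q | T ⊓ S = ⊥} (by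
      intro c hc hchain y hy
      refine ⟨sSup c, ?_, fun z hz => le_sSup hz⟩
      change sSup c ⊓ S = ⊥
      rw [Submodule.eq_bot_iff]
      rintro x ⟨hx, hxS⟩
      obtain ⟨Z, hZ, hxZ⟩ := (Submodule.mem_sSup_of_directed ⟨y, hy⟩ hchain.directedOn).1 hx
      have h1 : Z ⊓ S = ⊥ := hc hZ
      have h2 : x ∈ Z ⊓ S := ⟨hxZ, hxS⟩
      rwa [h1] at h2) ⊥ (bot_inf_eq S)
  have hTS : T ⊓ S = ⊥ := hT.prop
  have hφ : Function.Injective (T.mkQ ∘ₗ S.subtype) := by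
    rw [← LinearMap.ker_eq_bot, Submodule.eq_bot_iff]
    rintro ⟨x, hx⟩ h
    have h3 : x ∈ T := by simpa using h
    have h2 : x ∈ T ⊓ S := ⟨h3, hx⟩
    rw [hTS] at h2
    exact Subtype.ext (by simpa using h2)
  obtain ⟨g, hg⟩ := hQ'.out (T.mkQ ∘ₗ S.subtype) hφ S.subtype
  -- a submodule of `Q / T` that meets the image of `S` trivially is trivial
  have hess2 : ∀ W : Submodule R (Q ⧸ T), W ⊓ S.map T.mkQ = ⊥ → W = ⊥ := by
    intro W hW
    have hle : T ≤ W.comap T.mkQ := by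
      intro x hx
      have h0 : T.mkQ x = 0 := by simpa using hx
      rw [Submodule.mem_comap, h0]
      exact zero_mem _
    have hmem : W.comap T.mkQ ⊓ S = ⊥ := by
      rw [Submodule.eq_bot_iff]
      rintro x ⟨hx, hxS⟩
      have h2 : T.mkQ x ∈ W ⊓ S.map T.mkQ := ⟨hx, Submodule.mem_map_of_mem hxS⟩
      rw [hW] at h2
      have h3 : x ∈ T := by simpa using h2
      have h4 : x ∈ T ⊓ S := ⟨h3, hxS⟩
      rwa [hTS] at h4
    have heq : W.comap T.mkQ = T := le_antisymm (hT.le_of_ge hmem hle) hle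
    rw [Submodule.eq_bot_iff]
    intro w hw
    obtain ⟨x, rfl⟩ := T.mkQ_surjective w
    have h3 : x ∈ W.comap T.mkQ := hw
    rw [heq] at h3
    simpa using h3
  have hgker : LinearMap.ker g = ⊥ := by
    apply hess2
    rw [Submodule.eq_bot_iff]
    rintro w ⟨hw, s, hs, rfl⟩
    have h1 := hg ⟨s, hs⟩
    simp only [LinearMap.comp_apply, Submodule.subtype_apply] at h1
    have h2 : s = 0 := h1.symm.trans hw
    rw [h2, map_zero]
  have hSrange : S ≤ LinearMap.range g := fun s hs => ⟨_, hg ⟨s, hs⟩⟩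
  have hrange : LinearMap.range g ≤ S := by
    refine hS.le_of_ge ⟨hKS.trans hSrange, ?_⟩ hSrange
    intro W hW hWK
    have h1 : W ⊓ S = ⊥ := hess _ inf_le_right (by rw [inf_right_comm, hWK, bot_inf_eq])
    have h2 : W.comap g = ⊥ := by
      apply hess2
      rw [Submodule.eq_bot_iff]
      rintro w ⟨hw, s, hs, rfl⟩
      have h3 := hg ⟨s, hs⟩
      simp only [LinearMap.comp_apply, Submodule.subtype_apply] at h3
      have h4 : g (T.mkQ s) ∈ W := hw
      rw [h3] at h4
      have h5 : s ∈ W ⊓ S := ⟨h4, hs⟩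
      rw [h1] at h5
      have h6 : s = 0 := by simpa using h5
      rw [h6, map_zero]
    rw [Submodule.eq_bot_iff]
    intro w hw
    obtain ⟨v, rfl⟩ := hW hw
    have h3 : v ∈ W.comap g := hw
    rw [h2] at h3
    have h4 : v = 0 := by simpa using h3
    rw [h4, map_zero]
  -- `S` is a retract of `Q`
  let r : Q →ₗ[R] S := (g ∘ₗ T.mkQ).codRestrict S (fun q => hrange ⟨_, rfl⟩)
  have hr : ∀ s : S, r s = s := fun s => Subtype.ext (hg s)
  refine ⟨ModuleCat.of R S, i.hom.codRestrict S (fun x => hKS ⟨x, rfl⟩), ⟨⟨?_⟩, ?_, ?_⟩⟩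
  · intro X Y _ _ _ _ f hf p
    obtain ⟨q, hq⟩ := hQ'.out f hf (S.subtype ∘ₗ p)
    refine ⟨r ∘ₗ q, fun x => ?_⟩
    have h1 : q (f x) = (p x : Q) := hq x
    change r (q (f x)) = p x
    rw [h1]
    exact hr (p x)
  · intro a b hab
    exact hinj (congrArg Subtype.val hab)
  · intro W hW
    change Submodule R S at W
    have h1 : W.map S.subtype = ⊥ := by
      refine hess _ (Submodule.map_subtype_le S W) ?_
      rw [Submodule.eq_bot_iff]
      rintro _ ⟨⟨w, hw, rfl⟩, ⟨x, hx⟩⟩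
      have h2 : w ∈ W ⊓ LinearMap.range (i.hom.codRestrict S (fun x => hKS ⟨x, rfl⟩)) :=
        ⟨hw, x, Subtype.ext hx⟩
      have h3 : w ∈ (⊥ : Submodule R S) := hW ▸ h2
      have h4 : w = 0 := by simpa using h3
      rw [h4, map_zero]
    rw [Submodule.eq_bot_iff]
    intro w hw
    have h2 : (w : Q) ∈ W.map S.subtype := Submodule.mem_map_of_mem hw
    rw [h1] at h2
    exact Subtype.ext (by simpa using h2)

variable (R)

/-- `E_R(k)`: an injective hull of the residue field of the local ring `R`. -/
def residueHull [IsLocalRing R] : ModuleCat.{u} R :=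
  (exists_isInjectiveHull (R := R) (IsLocalRing.ResidueField R)).choose

theorem residueHull_spec [IsLocalRing R] :
    ∃ f : IsLocalRing.ResidueField R →ₗ[R] residueHull R, IsInjectiveHull f :=
  (exists_isInjectiveHull (R := R) (IsLocalRing.ResidueField R)).choose_spec

end InjectiveHull

/-! ### The canonical module and cl-rationality -/

section Rationality

variable (R : Type u) [CommRing R] [IsLocalRing R]

/-- The top local cohomology module `H_m^d(R)`, where `d` is the Krull dimension of the (Noetherian)
local ring `R` and `m` its maximal ideal. -/
def topLocalCohomology : ModuleCat.{u} R :=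
  (localCohomology (IsLocalRing.maximalIdeal R) ((ringKrullDim R).unbotD 0).toNat).obj
    (ModuleCat.of R R)

/-- The canonical module of a complete local ring: the Matlis dual `Hom_R(H_m^d(R), E_R(k))` of the
top local cohomology module. -/
abbrev CanonicalModule : Type u :=
  topLocalCohomology R →ₗ[R] residueHull R

variable {R}

/-- `Ann_ω N = {f ∈ Hom_R(H_m^d(R), E_R(k)) | f(N) = 0}` for a submodule `N` of `H_m^d(R)`. -/
def annCanonical (N : Submodule R (topLocalCohomology R)) : Submodule R (CanonicalModule R) where
  carrier := {f | ∀ η ∈ N, f η = 0}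
  add_mem' := by
    intro f g hf hg η hη
    rw [LinearMap.add_apply, hf η hη, hg η hη, add_zero]
  zero_mem' := fun _ _ => rfl
  smul_mem' := by
    intro c f hf η hη
    rw [LinearMap.smul_apply, hf η hη, smul_zero]

/-- `τ_cl(ω) = Ann_ω (0^cl)`, where the closure of `0` is taken in `H_m^d(R)`. -/
def testSubmodule (c : ClosureOperation R) : Submodule R (CanonicalModule R) :=
  annCanonical (c.cl (topLocalCohomology R) ⊥)

/-- The Cohen-Macaulay complete local ring `R` is `cl`-rational if `τ_cl(ω) = ω`. -/
def IsClRational (c : ClosureOperation R) : Prop :=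
  testSubmodule c = ⊤

end Rationality

/-! ### The ring `k[[x,y]]/(x^n + y^2)` -/

section CurveRing

variable (k : Type u) [Field k] (n : ℕ)

/-- `k[[x,y]]/(x^n + y^2)`. -/
abbrev CurveRing : Type u :=
  MvPowerSeries (Fin 2) k ⧸
    Ideal.span {(MvPowerSeries.X 0 ^ n + MvPowerSeries.X 1 ^ 2 : MvPowerSeries (Fin 2) k)}

/-- The class of `x`. -/
def CurveRing.x : CurveRing k n := Ideal.Quotient.mk _ (MvPowerSeries.X 0)

/-- The class of `y`. -/
def CurveRing.y : CurveRing k n := Ideal.Quotient.mk _ (MvPowerSeries.X 1)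

/-- The ideal `(x)`. -/
def CurveRing.idealX : Ideal (CurveRing k n) := Ideal.span {CurveRing.x k n}

/-- The ideal `I_i = (x^i, y)`. -/
def CurveRing.idealI (i : ℕ) : Ideal (CurveRing k n) :=
  Ideal.span {CurveRing.x k n ^ i, CurveRing.y k n}

/-- For `n ≥ 1` the ring `k[[x,y]]/(x^n + y^2)` is local. -/
instance CurveRing.isLocalRing [NeZero n] : IsLocalRing (CurveRing k n) := by
  have : Nontrivial (CurveRing k n) := by
    rw [Ideal.Quotient.nontrivial_iff, Ne, Ideal.span_singleton_eq_top]
    intro h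
    have h1 := h.map (MvPowerSeries.constantCoeff (σ := Fin 2) (R := k))
    simp [NeZero.ne n] at h1
  exact IsLocalRing.of_surjective' (Ideal.Quotient.mk _) Ideal.Quotient.mk_surjective

end CurveRing

end

/-! The relation $y^2=-x^n$ with $1\le i<n$ gives $yI_i\subseteq xI_i$: both $y\cdot x^i$ and
$y\cdot y$ lie in $xI_i$. So if a class $\zeta$ in a module satisfies $x\zeta=0$ and $b\in I_i$,
then writing $yb=xc$ with $c\in I_i$ gives $b\otimes y\zeta=xc\otimes\zeta=c\otimes x\zeta=0$, and
$y\zeta$ lies in the closure of $0$ (`smul_mem_moduleClosure_bot`). Since $E$ is a cogenerator, one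
nonzero element of $0^{\mathrm{cl}}$ in $H^d_{\mathfrak m}(R)$ already refutes rationality
(`not_isClRational`).

It remains to find $\zeta$ with $x\zeta=0$ and $y\zeta\ne0$. Here $d=1$ and $x$ is a nonzerodivisor
with $\mathfrak m^t\subseteq(x)$ for some $t$. The class $\zeta$ comes from
$\mathrm{Ext}^1(R/\mathfrak m^t,R)$: it is the image of the projection $R/\mathfrak m^t\to R/(x)$
under the connecting map of $0\to R\xrightarrow{x}R\to R/(x)\to0$. It is killed by $x$, and
$y\zeta=0$ would force $y\in(x)$ (`exists_localCohomology_one`).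

`Ext` is a left derived functor into an opposite category, so its elements are handled as morphisms
out of a homology object. -/

noncomputable section

/-! ### Morphisms out of homology and out of left derived functors. -/

section DerivedFunctorClasses

open CategoryTheory Limits

namespace ChainComplex

variable {D : Type*} [Category* D] [Abelian D] (K L : ChainComplex D ℕ) (n : ℕ) {J J' : D}

/-- The morphism out of homology given by a morphism on chains that kills boundaries. -/
def homologyDesc (h : K.X n ⟶ J) (hh : K.d (n + 1) n ≫ h = 0) : K.homology n ⟶ J :=
  K.homologyι n ≫ K.descOpcycles h (n + 1) (by simp) hh

theorem homologyDesc_comp (h : K.X n ⟶ J) (hh : K.d (n + 1) n ≫ h = 0) (g : J ⟶ J') :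
    K.homologyDesc n h hh ≫ g =
      K.homologyDesc n (h ≫ g) (by rw [← Category.assoc, hh, zero_comp]) := by
  simp only [homologyDesc, Category.assoc, HomologicalComplex.descOpcycles_comp]

variable {K L} in
theorem homologyMap_comp_homologyDesc (φ : K ⟶ L) (h : L.X n ⟶ J)
    (hh : L.d (n + 1) n ≫ h = 0) :
    HomologicalComplex.homologyMap φ n ≫ L.homologyDesc n h hh =
      K.homologyDesc n (φ.f n ≫ h) (by
        rw [← Category.assoc, ← φ.comm, Category.assoc, hh, comp_zero]) := by
  simp only [homologyDesc, HomologicalComplex.homologyι_naturality_assoc]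
  congr 1
  simp

/-- Homology is the kernel of the map from opcycles to the previous term, so a morphism on opcycles
vanishing on it extends along that map because `J` is injective. -/
theorem homologyDesc_eq_zero_iff [Injective J] (h : K.X (n + 1) ⟶ J)
    (hh : K.d (n + 2) (n + 1) ≫ h = 0) :
    K.homologyDesc (n + 1) h hh = 0 ↔ ∃ s : K.X n ⟶ J, K.d (n + 1) n ≫ s = h := by
  constructor
  · intro h0
    have hS := ShortComplex.exact_of_f_is_kernel
      (ShortComplex.mk _ _ (K.homologyι_comp_fromOpcycles (n + 1) n))
      (K.homologyIsKernel (n + 1) n (by simp))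
    refine ⟨hS.descToInjective _ h0, ?_⟩
    have h2 := hS.comp_descToInjective _ h0
    have h3 := congrArg (fun q => K.pOpcycles (n + 1) ≫ q) h2
    simpa using h3
  · rintro ⟨s, hs⟩
    exact K.homologyι_descOpcycles_eq_zero_of_boundary h (n + 2) (by simp) s hs.symm

end ChainComplex

namespace CategoryTheory.ProjectiveResolution

variable {C D : Type*} [Category* C] [Abelian C] [HasProjectiveResolutions C] [Category* D]
  [Abelian D] {X Y : C} (P : ProjectiveResolution X) (Q : ProjectiveResolution Y) (F : C ⥤ D)
  [F.Additive] (n : ℕ) {J : D}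

/-- The image of a projective resolution under an additive functor. -/
abbrev mapComplex : ChainComplex D ℕ :=
  (F.mapHomologicalComplex (ComplexShape.down ℕ)).obj P.complex

/-- A left derived functor as the homology of the image of a projective resolution. -/
def leftDerivedIso : (F.leftDerived n).obj X ≅ (P.mapComplex F).homology n :=
  P.isoLeftDerivedObj F n

variable {P Q} in
theorem map_comp_leftDerivedIso_hom (f : X ⟶ Y) (φ : P.complex ⟶ Q.complex)
    (comm : φ.f 0 ≫ Q.π.f 0 = P.π.f 0 ≫ f) :
    (F.leftDerived n).map f ≫ (Q.leftDerivedIso F n).hom =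
      (P.leftDerivedIso F n).hom ≫
        HomologicalComplex.homologyMap ((F.mapHomologicalComplex _).map φ) n :=
  isoLeftDerivedObj_hom_naturality f P Q φ comm F n

/-- The morphism out of a left derived functor given by a morphism on a term of a projective
resolution that kills boundaries. -/
def leftDerivedDesc (h : (P.mapComplex F).X n ⟶ J)
    (hh : (P.mapComplex F).d (n + 1) n ≫ h = 0) : (F.leftDerived n).obj X ⟶ J :=
  (P.leftDerivedIso F n).hom ≫ (P.mapComplex F).homologyDesc n h hh

theorem leftDerivedDesc_comp {J' : D} (h : (P.mapComplex F).X n ⟶ J)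
    (hh : (P.mapComplex F).d (n + 1) n ≫ h = 0) (g : J ⟶ J')
    {h' : (P.mapComplex F).X n ⟶ J'} (e : h ≫ g = h') :
    P.leftDerivedDesc F n h hh ≫ g =
      P.leftDerivedDesc F n h' (by rw [← e, ← Category.assoc, hh, zero_comp]) := by
  subst e
  rw [leftDerivedDesc, Category.assoc, ChainComplex.homologyDesc_comp, leftDerivedDesc]

variable {P Q} in
theorem map_comp_leftDerivedDesc (f : X ⟶ Y) (φ : P.complex ⟶ Q.complex)
    (comm : φ.f 0 ≫ Q.π.f 0 = P.π.f 0 ≫ f) (h : (Q.mapComplex F).X n ⟶ J)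
    (hh : (Q.mapComplex F).d (n + 1) n ≫ h = 0) :
    (F.leftDerived n).map f ≫ Q.leftDerivedDesc F n h hh =
      P.leftDerivedDesc F n (((F.mapHomologicalComplex _).map φ).f n ≫ h) (by
        rw [← Category.assoc, ← HomologicalComplex.Hom.comm, Category.assoc, hh, comp_zero]) := by
  rw [leftDerivedDesc, ← Category.assoc, map_comp_leftDerivedIso_hom F n f φ comm,
    Category.assoc, ChainComplex.homologyMap_comp_homologyDesc, leftDerivedDesc]

theorem leftDerivedDesc_eq_zero_iff [Injective J] (h : (P.mapComplex F).X (n + 1) ⟶ J)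
    (hh : (P.mapComplex F).d (n + 2) (n + 1) ≫ h = 0) :
    P.leftDerivedDesc F (n + 1) h hh = 0 ↔
      ∃ s : (P.mapComplex F).X n ⟶ J, (P.mapComplex F).d (n + 1) n ≫ s = h := by
  rw [leftDerivedDesc, Preadditive.IsIso.comp_left_eq_zero, ChainComplex.homologyDesc_eq_zero_iff]

end CategoryTheory.ProjectiveResolution

end DerivedFunctorClasses

/-! ### Elements of Ext as cocycles modulo coboundaries. -/

section ExtClasses

open CategoryTheory Limits Opposite

namespace CategoryTheory.ProjectiveResolution

variable {R : Type u} [CommRing R] {M M' : ModuleCat.{u} R} (P : ProjectiveResolution M)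
  (P' : ProjectiveResolution M') {N : ModuleCat.{u} R} (n : ℕ)

/-- An element of a hom-module as a morphism in the opposite category. -/
def homToOp {A : ModuleCat.{u} R} (h : A ⟶ N) :
    ((linearYoneda R (ModuleCat.{u} R)).obj N).rightOp.obj A ⟶ op (ModuleCat.of R R) :=
  (ModuleCat.ofHom (LinearMap.toSpanSingleton R (A ⟶ N) h)).op

theorem map_comp_homToOp {A B : ModuleCat.{u} R} (g : A ⟶ B) (h : B ⟶ N) :
    ((linearYoneda R (ModuleCat.{u} R)).obj N).rightOp.map g ≫ homToOp h = homToOp (g ≫ h) := by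
  apply Quiver.Hom.unop_inj
  apply ModuleCat.hom_ext
  apply LinearMap.ext_ring
  change g ≫ ((1 : R) • h) = (1 : R) • (g ≫ h)
  simp

theorem homToOp_zero {A : ModuleCat.{u} R} : homToOp (0 : A ⟶ N) = 0 := by
  apply Quiver.Hom.unop_inj
  apply ModuleCat.hom_ext
  apply LinearMap.ext_ring
  change (1 : R) • (0 : A ⟶ N) = 0
  simp

theorem map_comp_homToOp_eq_zero {A B : ModuleCat.{u} R} {g : A ⟶ B} {h : B ⟶ N}
    (hgh : g ≫ h = 0) :
    ((linearYoneda R (ModuleCat.{u} R)).obj N).rightOp.map g ≫ homToOp h = 0 :=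
  (map_comp_homToOp g h).trans ((congrArg homToOp hgh).trans homToOp_zero)

theorem homToOp_bijective {A : ModuleCat.{u} R} :
    Function.Bijective (homToOp : (A ⟶ N) → _) := by
  constructor
  · intro h h' e
    have := congrArg (fun q => q.unop.hom (1 : R)) e
    change (1 : R) • h = (1 : R) • h' at this
    simpa using this
  · intro q
    refine ⟨q.unop.hom (1 : R), ?_⟩
    apply Quiver.Hom.unop_inj
    apply ModuleCat.hom_ext
    apply LinearMap.ext_ring
    change (1 : R) • q.unop.hom (1 : R) = q.unop.hom (1 : R)
    simp

/-- The element of `Ext` given by a cocycle on a projective resolution. -/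
def extClass (h : P.complex.X n ⟶ N) (hh : P.complex.d (n + 1) n ≫ h = 0) :
    ((Ext R (ModuleCat.{u} R) n).obj (op M)).obj N :=
  (P.leftDerivedDesc ((linearYoneda R (ModuleCat.{u} R)).obj N).rightOp n (homToOp h)
    (map_comp_homToOp_eq_zero hh)).unop.hom (1 : R)

/-- The injectivity needed holds because $R$ is projective, so `op R` is injective in the opposite
category. -/
theorem extClass_eq_zero_iff (h : P.complex.X (n + 1) ⟶ N)
    (hh : P.complex.d (n + 2) (n + 1) ≫ h = 0) :
    P.extClass (n + 1) h hh = 0 ↔ ∃ s : P.complex.X n ⟶ N, P.complex.d (n + 1) n ≫ s = h := by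
  have key := P.leftDerivedDesc_eq_zero_iff ((linearYoneda R (ModuleCat.{u} R)).obj N).rightOp n
    (homToOp h) (map_comp_homToOp_eq_zero hh)
  trans P.leftDerivedDesc ((linearYoneda R (ModuleCat.{u} R)).obj N).rightOp (n + 1)
    (homToOp h) (map_comp_homToOp_eq_zero hh) = 0
  · constructor
    · intro e
      apply Quiver.Hom.unop_inj
      apply ModuleCat.hom_ext
      exact LinearMap.ext_ring e
    · intro e
      rw [extClass, e]
      rfl
  · rw [key]
    constructor
    · rintro ⟨s, hs⟩
      obtain ⟨s, rfl⟩ := homToOp_bijective.2 s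
      exact ⟨s, homToOp_bijective.1 ((map_comp_homToOp _ _).symm.trans hs)⟩
    · rintro ⟨s, hs⟩
      exact ⟨homToOp s, (map_comp_homToOp _ _).trans (by rw [hs])⟩

theorem smul_extClass (r : R) (h : P.complex.X n ⟶ N) (hh : P.complex.d (n + 1) n ≫ h = 0) :
    r • P.extClass n h hh = P.extClass n (r • h) (by rw [Linear.comp_smul, hh, smul_zero]) := by
  have e : homToOp h ≫ (ModuleCat.ofHom (LinearMap.toSpanSingleton R R r)).op =
      homToOp (r • h) := by
    apply Quiver.Hom.unop_inj
    apply ModuleCat.hom_ext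
    apply LinearMap.ext_ring
    change ((1 : R) * r) • h = (1 : R) • r • h
    simp
  have key := P.leftDerivedDesc_comp ((linearYoneda R (ModuleCat.{u} R)).obj N).rightOp n
    (homToOp h) (map_comp_homToOp_eq_zero hh) _ e
  refine Eq.trans ?_ (congrArg (fun q => q.unop.hom (1 : R)) key)
  exact ((P.leftDerivedDesc ((linearYoneda R (ModuleCat.{u} R)).obj N).rightOp n
    (homToOp h) (map_comp_homToOp_eq_zero hh)).unop.hom.map_smul r (1 : R)).symm.trans
      (congrArg _ (mul_comm r 1))

variable {P P'} in
theorem map_extClass (f : M' ⟶ M) (φ : P'.complex ⟶ P.complex)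
    (comm : φ.f 0 ≫ P.π.f 0 = P'.π.f 0 ≫ f) (h : P.complex.X n ⟶ N)
    (hh : P.complex.d (n + 1) n ≫ h = 0) :
    (((Ext R (ModuleCat.{u} R) n).map f.op).app N).hom (P.extClass n h hh) =
      P'.extClass n (φ.f n ≫ h) (by
        rw [← Category.assoc, ← φ.comm, Category.assoc, hh, comp_zero]) := by
  have key := map_comp_leftDerivedDesc ((linearYoneda R (ModuleCat.{u} R)).obj N).rightOp n
    f φ comm (homToOp h) (map_comp_homToOp_eq_zero hh)
  refine (congrArg (fun q => q.unop.hom (1 : R)) key).trans ?_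
  congr 4

end CategoryTheory.ProjectiveResolution

end ExtClasses

/-! ### An $x$-torsion class in first local cohomology. -/

section LocalCohomologyElement

open CategoryTheory Limits Opposite

variable {R : Type u} [CommRing R]

/-- Multiplication by `x` on `R`, in `ModuleCat R`. -/
abbrev mulHom (x : R) : ModuleCat.of R R ⟶ ModuleCat.of R R :=
  ModuleCat.ofHom (LinearMap.toSpanSingleton R R x)

theorem comp_mulHom {A : ModuleCat.{u} R} (g : A ⟶ ModuleCat.of R R) (x : R) :
    g ≫ mulHom x = x • g := by
  ext a
  exact mul_comm _ _

theorem mono_mulHom {x : R} (hx : x ∈ nonZeroDivisors R) : Mono (mulHom x) := by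
  rw [ModuleCat.mono_iff_injective]
  intro a b hab
  exact (mul_cancel_right_mem_nonZeroDivisors hx).1 hab

/-- Morphisms to `R` with values in `(x)` are multiples of `x` when `x` is a nonzerodivisor. -/
theorem exists_smul_eq_of_forall_mem_span_singleton {x : R} {A : ModuleCat.{u} R}
    (g : A ⟶ ModuleCat.of R R)
    (hg : ∀ a, g.hom a ∈ Ideal.span {x}) (hx : x ∈ nonZeroDivisors R) :
    ∃ h : A ⟶ ModuleCat.of R R, x • h = g := by
  choose c hc using fun a => Ideal.mem_span_singleton'.1 (hg a)
  refine ⟨ModuleCat.ofHom ⟨⟨c, fun a b => ?_⟩, fun r a => ?_⟩, ?_⟩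
  · apply (mul_cancel_right_mem_nonZeroDivisors hx).1
    rw [hc, add_mul, hc, hc, map_add]
  · apply (mul_cancel_right_mem_nonZeroDivisors hx).1
    rw [hc, map_smul, RingHom.id_apply, smul_mul_assoc, hc]
  · ext a
    exact (mul_comm _ _).trans (hc a)

/-- A morphism to `R` from a module annihilated by a power of a nonzerodivisor vanishes. -/
theorem eq_zero_of_pow_smul_eq_zero {x : R} (hx : x ∈ nonZeroDivisors R) {A : ModuleCat.{u} R}
    {s : ℕ} (w : A ⟶ ModuleCat.of R R) (h : ∀ a : A, x ^ s • a = 0) : w = 0 := by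
  ext a
  have h1 := w.hom.map_smul (x ^ s) a
  rw [h, map_zero] at h1
  exact (mul_left_mem_nonZeroDivisors_eq_zero_iff (pow_mem hx s)).1 h1.symm

/-- If `x ∈ J` is a nonzerodivisor and `(x)` contains a power of `J`, then every `y ∉ (x)` acts
nontrivially on the `x`-torsion of `H_J^1(R)`. -/
theorem exists_localCohomology_one {J : Ideal R} {x y : R} {t : ℕ} (hxJ : x ∈ J)
    (hx : x ∈ nonZeroDivisors R) (hJ : J ^ t ≤ Ideal.span {x}) (hy : y ∉ Ideal.span {x}) :
    ∃ ζ : (localCohomology J 1).obj (ModuleCat.of R R), x • ζ = 0 ∧ y • ζ ≠ 0 := by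
  let I := localCohomology.idealPowersDiagram J
  let M := localCohomology.ringModIdeals I
  let P (s : ℕᵒᵖ) : ProjectiveResolution (M.obj s) := projectiveResolution _
  let q : ModuleCat.of R R ⟶ ModuleCat.of R (R ⧸ Ideal.span {x}) :=
    ModuleCat.ofHom (Submodule.mkQ _)
  have hq : Epi q := (ModuleCat.epi_iff_surjective _).2 (Submodule.mkQ_surjective _)
  let t₀ : ℕᵒᵖ := op t
  let π : M.obj t₀ ⟶ ModuleCat.of R (R ⧸ Ideal.span {x}) :=
    ModuleCat.ofHom (Submodule.mapQ (J ^ t) _ LinearMap.id hJ)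
  let p : (P t₀).complex.X 0 ⟶ M.obj t₀ := (P t₀).π.f 0
  let g : (P t₀).complex.X 0 ⟶ ModuleCat.of R R := Projective.factorThru (p ≫ π) q
  have hg : g ≫ q = p ≫ π := Projective.factorThru_comp _ _
  have hdg : ((P t₀).complex.d 1 0 ≫ g) ≫ q = 0 := by
    rw [Category.assoc, hg, ← Category.assoc]
    have : (P t₀).complex.d 1 0 ≫ p = 0 := (P t₀).complex_d_comp_π_f_zero
    rw [this, zero_comp]
  -- The map `g` lifts $R/J^t\to R/(x)$, so its restriction to boundaries has values in $(x)$;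
  -- dividing by $x$ gives the connecting cocycle `h`, and $xh$ is the coboundary of `g`.
  obtain ⟨h, hh⟩ := exists_smul_eq_of_forall_mem_span_singleton
    ((P t₀).complex.d 1 0 ≫ g) (x := x)
    (fun a => (Submodule.Quotient.mk_eq_zero _).1 (congrArg (fun f => f.hom a) hdg)) hx
  have hcoc : (P t₀).complex.d 2 1 ≫ h = 0 := by
    have := mono_mulHom hx
    rw [← cancel_mono (mulHom x), Category.assoc, comp_mulHom, hh, zero_comp,
      ← Category.assoc, HomologicalComplex.d_comp_d, zero_comp]
  let c := (P t₀).extClass 1 h hcoc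
  have hxc : x • c = 0 := by
    rw [ProjectiveResolution.smul_extClass, ProjectiveResolution.extClass_eq_zero_iff]
    exact ⟨g, hh.symm⟩
  let D := ((evaluation _ _).obj (ModuleCat.of R R)).mapCocone
    (colimit.cocone (localCohomology.diagram I 1))
  have hD : IsColimit D := isColimitOfPreserves _ (colimit.isColimit _)
  refine ⟨(D.ι.app (op t₀)).hom c, ?_, ?_⟩
  · exact ((D.ι.app (op t₀)).hom.map_smul x c).symm.trans
      ((congrArg _ hxc).trans (map_zero _))
  intro h0
  have h1 : (D.ι.app (op t₀)).hom (y • c) = (D.ι.app (op t₀)).hom 0 :=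
    (((D.ι.app (op t₀)).hom.map_smul y c).trans h0).trans (map_zero _).symm
  have : PreservesFilteredColimitsOfSize.{0, 0} (forget (ModuleCat.{u} R)) :=
    preservesFilteredColimitsOfSize_shrink.{0, u, 0, u} _
  -- An element dies in a filtered colimit only if it dies at some stage, here $R/J^s\to R/J^t$.
  obtain ⟨k, f, f', hf⟩ := Concrete.isColimit_exists_of_rep_eq _ hD _ _ h1
  let s : ℕᵒᵖ := k.unop
  let φ := ProjectiveResolution.lift (M.map f.unop) (P s) (P t₀)
  have comm : φ.f 0 ≫ (P t₀).π.f 0 = (P s).π.f 0 ≫ M.map f.unop :=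
    ProjectiveResolution.lift_commutes_zero _ _ _
  have h2 : (P s).extClass 1 (φ.f 1 ≫ (y • h)) (by
      rw [← Category.assoc, ← φ.comm, Category.assoc, Linear.comp_smul, hcoc, smul_zero,
        comp_zero]) = 0 := by
    rw [← ProjectiveResolution.map_extClass 1 _ φ comm, ← ProjectiveResolution.smul_extClass]
    · exact hf.trans (map_zero _)
    · rw [Linear.comp_smul, hcoc, smul_zero]
  obtain ⟨v, hv⟩ := ((P s).extClass_eq_zero_iff 0 _ _).1 h2
  have h3 : (P s).complex.d 1 0 ≫ (y • (φ.f 0 ≫ g) - x • v) = 0 := by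
    rw [Preadditive.comp_sub, Linear.comp_smul, Linear.comp_smul, hv, ← Category.assoc,
      ← φ.comm, Category.assoc, ← hh]
    simp [smul_comm x y]
  -- A map vanishing on boundaries factors through $R/J^s$, which is killed by $x^s$, and so has no
  -- nonzero map to $R$.
  have h4 : y • (φ.f 0 ≫ g) - x • v = 0 := by
    obtain ⟨w, hw⟩ := CokernelCofork.IsColimit.desc' (P s).isColimitCokernelCofork _ h3
    rw [← hw, eq_zero_of_pow_smul_eq_zero hx (s := s.unop) w, comp_zero]
    intro a
    obtain ⟨r, rfl⟩ := Submodule.mkQ_surjective _ a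
    exact (Submodule.Quotient.mk_eq_zero _).2
      (Ideal.mul_mem_right r _ (Ideal.pow_mem_pow hxJ s.unop))
  let ps : (P s).complex.X 0 ⟶ M.obj s := (P s).π.f 0
  have comm' : φ.f 0 ≫ p = ps ≫ M.map f.unop := comm
  have : Epi ps := inferInstanceAs (Epi ((P s).π.f 0))
  -- Reducing `h4` modulo $x$ removes `v`; evaluating at $1\in R/J^s$ then gives $y\in(x)$.
  have h5 : ps ≫ (y • (M.map f.unop ≫ π)) = 0 := by
    have h6 := congrArg (fun w => w ≫ q) h4
    have h7 : (x • v) ≫ q = 0 := by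
      ext a
      exact (Submodule.Quotient.mk_eq_zero _).2
        (Ideal.mul_mem_right _ _ (Ideal.mem_span_singleton_self x))
    simp only [Preadditive.sub_comp, h7, sub_zero, zero_comp, Linear.smul_comp, Category.assoc,
      hg] at h6
    rw [Linear.comp_smul, ← Category.assoc, ← comm', Category.assoc]
    exact h6
  have h8 := (cancel_epi _).1 (h5.trans comp_zero.symm)
  have h9 := congrArg (fun w => w.hom (Submodule.Quotient.mk 1)) h8
  have h10 : (Submodule.Quotient.mk (y * 1) : R ⧸ Ideal.span {x}) = 0 := h9
  rw [mul_one] at h10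
  exact hy ((Submodule.Quotient.mk_eq_zero _).1 h10)

end LocalCohomologyElement

/-! ### Failure of rationality from a nonzero element of the closure of zero. -/

section InjectiveHullSeparation

variable {R : Type u} [CommRing R] [IsLocalRing R]

/-- An injective hull of the residue field is a cogenerator. -/
theorem exists_residueHull_apply_ne_zero {H : Type u} [AddCommGroup H] [Module R H] {η : H}
    (hη : η ≠ 0) : ∃ f : H →ₗ[R] residueHull R, f η ≠ 0 := by
  obtain ⟨e, he⟩ := residueHull_spec R
  -- $R\eta\cong R/A$ with $A\subseteq\mathfrak m$ maps onto the residue field; the composite to $E$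
  -- extends to `H` by injectivity.
  let A : Ideal R := LinearMap.ker (LinearMap.toSpanSingleton R H η)
  have hA : A ≤ IsLocalRing.maximalIdeal R := by
    refine IsLocalRing.le_maximalIdeal fun h => hη ?_
    have h1 : (1 : R) ∈ A := h ▸ Submodule.mem_top
    simpa [A] using h1
  let j : (R ⧸ A) →ₗ[R] H := Submodule.liftQ A (LinearMap.toSpanSingleton R H η) le_rfl
  have hj : Function.Injective j := by
    rw [← LinearMap.ker_eq_bot]
    exact Submodule.ker_liftQ_eq_bot' _ _ rfl
  let g : (R ⧸ A) →ₗ[R] residueHull R :=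
    e ∘ₗ Submodule.liftQ A (Algebra.linearMap R (IsLocalRing.ResidueField R)) (by
      intro a ha
      exact (IsLocalRing.residue_eq_zero_iff a).2 (hA ha))
  obtain ⟨f, hf⟩ := he.module_injective.out j hj g
  refine ⟨f, ?_⟩
  have h1 : j (Submodule.Quotient.mk 1) = η := one_smul R η
  have h2 : g (Submodule.Quotient.mk 1) = e 1 :=
    congrArg e (map_one (algebraMap R (IsLocalRing.ResidueField R)))
  rw [← h1, hf, h2, ← map_zero e]
  exact he.injective.ne one_ne_zero

/-- A closure operation for which `0` is not closed in `H_m^d(R)` violates rationality. -/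
theorem not_isClRational {c : ClosureOperation R} {η : topLocalCohomology R} (hη : η ≠ 0)
    (hc : η ∈ c.cl (topLocalCohomology R) ⊥) :
    ¬ IsClRational c := by
  intro h
  obtain ⟨f, hf⟩ := exists_residueHull_apply_ne_zero (R := R) hη
  have : f ∈ testSubmodule c := by
    rw [show testSubmodule c = ⊤ from h]
    exact Submodule.mem_top
  exact hf (this η hc)

end InjectiveHullSeparation

/-- If `y` multiplies the ideal `I` into `xI` and `x` kills `ζ`, then `yζ` lies in the
`I`-module closure of `0`. -/
theorem smul_mem_moduleClosure_bot {R : Type u} [CommRing R] {I : Ideal R} {x y : R}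
    (hy : y ∈ (I * Ideal.span {x}).colon (I : Set R)) {H : Type u} [AddCommGroup H] [Module R H]
    {ζ : H} (hζ : x • ζ = 0) : y • ζ ∈ (moduleClosure R I).cl H ⊥ := by
  intro b
  obtain ⟨c, hc, hcb⟩ := Ideal.mem_mul_span_singleton.1 (Submodule.mem_colon.1 hy b b.2)
  have h1 : y • b = x • (⟨c, hc⟩ : I) := Subtype.ext (hcb.symm.trans (mul_comm c x))
  rw [← TensorProduct.smul_tmul, h1, TensorProduct.smul_tmul, hζ, TensorProduct.tmul_zero]
  exact zero_mem _

/-! ### The curve $x^n+y^2=0$: colon ideal, regular parameter, dimension. -/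

section CurveRingFacts

variable (k : Type u) [Field k] (n : ℕ)

namespace CurveRing

theorem y_sq : y k n ^ 2 = -(x k n ^ n) := by
  rw [eq_neg_iff_add_eq_zero, add_comm]
  exact (Ideal.Quotient.eq_zero_iff_mem (I := Ideal.span
    {(MvPowerSeries.X 0 ^ n + MvPowerSeries.X 1 ^ 2 : MvPowerSeries (Fin 2) k)})).2
      (Ideal.mem_span_singleton_self _)

variable {n} in
theorem y_mem_colon {i : ℕ} (hi : 1 ≤ i) (hin : i < n) :
    y k n ∈ (idealI k n i * idealX k n).colon (idealI k n i : Set (CurveRing k n)) := by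
  have hx : x k n ^ i ∈ idealI k n i := Ideal.subset_span (by simp)
  have hy : y k n ∈ idealI k n i := Ideal.subset_span (by simp)
  have hxX : x k n ∈ idealX k n := Ideal.mem_span_singleton_self _
  rw [idealI, Submodule.colon_span, Submodule.mem_colon]
  rintro _ (rfl | rfl)
  · have e : y k n • x k n ^ i = x k n ^ (i - 1) * y k n * x k n := by
      obtain ⟨j, rfl⟩ := Nat.exists_eq_add_of_le' hi
      rw [smul_eq_mul, Nat.add_sub_cancel]
      ring
    exact e ▸ Ideal.mul_mem_mul (Ideal.mul_mem_left _ _ hy) hxX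
  · have e : y k n • y k n = x k n ^ i * (-(x k n ^ (n - i - 1))) * x k n := by
      have hpow : x k n ^ n = x k n ^ i * x k n ^ (n - i - 1) * x k n := by
        rw [← pow_add, ← pow_succ]
        congr 1
        omega
      rw [smul_eq_mul]
      linear_combination y_sq k n - hpow
    exact e ▸ Ideal.mul_mem_mul (Ideal.mul_mem_right _ _ hx) hxX

variable {n} in
theorem y_notMem_idealX (hn : n ≠ 0) : y k n ∉ idealX k n := by
  intro h
  obtain ⟨a, ha⟩ := Ideal.mem_span_singleton'.1 h
  obtain ⟨a, rfl⟩ := Ideal.Quotient.mk_surjective a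
  rw [x, y, ← map_mul, Ideal.Quotient.mk_eq_mk_iff_sub_mem, Ideal.mem_span_singleton'] at ha
  obtain ⟨b, hb⟩ := ha
  classical
  obtain ⟨m, rfl⟩ := Nat.exists_eq_succ_of_ne_zero hn
  -- The coefficient of $y$ is $1$ on the left and $0$ in both terms on the right.
  have h1 : (MvPowerSeries.X 1 : MvPowerSeries (Fin 2) k) =
      MvPowerSeries.X 0 * (a - b * MvPowerSeries.X 0 ^ m) +
        MvPowerSeries.X 1 ^ 2 * (-b) := by
    rw [Nat.succ_eq_add_one, pow_succ] at hb
    linear_combination hb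
  have h2 := (MvPowerSeries.X_dvd_iff (s := (0 : Fin 2))).1 (Dvd.intro (a - b * MvPowerSeries.X 0 ^ m) rfl)
    (Finsupp.single (1 : Fin 2) 1) (Finsupp.single_eq_of_ne (by decide))
  have h3 := (MvPowerSeries.X_pow_dvd_iff (s := (1 : Fin 2))).1 (Dvd.intro (-b) rfl)
    (Finsupp.single (1 : Fin 2) 1) (by rw [Finsupp.single_eq_same]; exact one_lt_two)
  have h4 := congrArg (MvPowerSeries.coeff (Finsupp.single (1 : Fin 2) 1)) h1
  rw [map_add, h2, h3, MvPowerSeries.coeff_index_single_self_X, add_zero] at h4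
  exact one_ne_zero h4

variable {n} in
-- If $ax=b(x^n+y^2)$ in $k[[x,y]]$, then $x$ divides $by^2$, hence $b$, and cancelling $x$ puts $a$
-- in the ideal of the curve.
theorem x_mem_nonZeroDivisors (hn : n ≠ 0) : x k n ∈ nonZeroDivisors (CurveRing k n) := by
  rw [mem_nonZeroDivisors_iff_right]
  intro a ha
  obtain ⟨a, rfl⟩ := Ideal.Quotient.mk_surjective a
  rw [x, ← map_mul, Ideal.Quotient.eq_zero_iff_mem, Ideal.mem_span_singleton'] at ha
  rw [Ideal.Quotient.eq_zero_iff_mem, Ideal.mem_span_singleton]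
  obtain ⟨b, hb⟩ := ha
  have hX : (MvPowerSeries.X 0 : MvPowerSeries (Fin 2) k) ≠ 0 := fun h => by
    have h1 := congrArg (MvPowerSeries.coeff (Finsupp.single (0 : Fin 2) 1)) h
    rw [MvPowerSeries.coeff_index_single_self_X, map_zero] at h1
    exact one_ne_zero h1
  obtain ⟨c, rfl⟩ : (MvPowerSeries.X 0 : MvPowerSeries (Fin 2) k) ∣ b := by
    obtain ⟨m, rfl⟩ := Nat.exists_eq_succ_of_ne_zero hn
    have hdvd : (MvPowerSeries.X 0 : MvPowerSeries (Fin 2) k) ∣ b * MvPowerSeries.X 1 ^ 2 :=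
      ⟨a - b * MvPowerSeries.X 0 ^ m, by
        rw [Nat.succ_eq_add_one, pow_succ] at hb
        linear_combination hb⟩
    rw [MvPowerSeries.X_dvd_iff] at hdvd ⊢
    intro e he
    have h1 := hdvd (e + Finsupp.single 1 2) (by simp [he])
    rwa [MvPowerSeries.X_pow_eq, MvPowerSeries.coeff_add_mul_monomial, mul_one] at h1
  refine ⟨c, mul_left_cancel₀ hX ?_⟩
  linear_combination -hb

theorem mem_span_X_of_constantCoeff_eq_zero {f : MvPowerSeries (Fin 2) k}
    (hf : MvPowerSeries.constantCoeff f = 0) :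
    f ∈ Ideal.span {(MvPowerSeries.X 0 : MvPowerSeries (Fin 2) k), MvPowerSeries.X 1} := by
  -- The part of `f` free of $x$: the rest is divisible by $x$, and `g` by $y$ since `f` has no
  -- constant term.
  let g : MvPowerSeries (Fin 2) k := fun e => if e 0 = 0 then MvPowerSeries.coeff e f else 0
  have hg (e) : MvPowerSeries.coeff e g = if e 0 = 0 then MvPowerSeries.coeff e f else 0 := rfl
  have h0 : MvPowerSeries.X 0 ∣ f - g := by
    rw [MvPowerSeries.X_dvd_iff]
    intro e he
    rw [map_sub, hg, if_pos he, sub_self]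
  have h1 : MvPowerSeries.X 1 ∣ g := by
    rw [MvPowerSeries.X_dvd_iff]
    intro e he
    rw [hg]
    split_ifs with h
    · have he0 : e = 0 := by
        ext j
        fin_cases j
        · exact h
        · exact he
      rwa [he0]
    · rfl
  rw [Ideal.mem_span_pair]
  obtain ⟨a, ha⟩ := h0
  obtain ⟨b, hb⟩ := h1
  exact ⟨a, b, by linear_combination -ha - hb⟩

variable [NeZero n]

theorem x_mem_maximalIdeal : x k n ∈ IsLocalRing.maximalIdeal (CurveRing k n) := fun h =>
  y_notMem_idealX k (NeZero.ne n)
    (Ideal.mem_span_singleton.2 (IsUnit.dvd h))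

theorem maximalIdeal_eq : IsLocalRing.maximalIdeal (CurveRing k n) = Ideal.span {x k n, y k n} := by
  apply le_antisymm
  · intro r hr
    obtain ⟨f, rfl⟩ := Ideal.Quotient.mk_surjective r
    have hf : MvPowerSeries.constantCoeff f = 0 := by
      by_contra h
      exact hr ((MvPowerSeries.isUnit_iff_constantCoeff.2 (isUnit_iff_ne_zero.2 h)).map _)
    have h1 := Ideal.mem_map_of_mem (Ideal.Quotient.mk (Ideal.span
      {(MvPowerSeries.X 0 ^ n + MvPowerSeries.X 1 ^ 2 : MvPowerSeries (Fin 2) k)}))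
      (mem_span_X_of_constantCoeff_eq_zero k hf)
    rwa [Ideal.map_span, Set.image_pair] at h1
  · rw [Ideal.span_le]
    rintro _ (rfl | rfl)
    · exact x_mem_maximalIdeal k n
    · refine Ideal.IsPrime.mem_of_pow_mem inferInstance 2 ?_
      rw [y_sq]
      exact neg_mem (Ideal.pow_mem_of_mem _ (x_mem_maximalIdeal k n) n
        (Nat.pos_of_ne_zero (NeZero.ne n)))

theorem maximalIdeal_le_radical : IsLocalRing.maximalIdeal (CurveRing k n) ≤ (idealX k n).radical := by
  rw [maximalIdeal_eq, Ideal.span_le]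
  have hx : x k n ∈ idealX k n := Ideal.mem_span_singleton_self _
  rintro _ (rfl | rfl)
  · exact Ideal.le_radical hx
  · refine ⟨2, ?_⟩
    rw [y_sq]
    exact neg_mem (Ideal.pow_mem_of_mem _ hx n (Nat.pos_of_ne_zero (NeZero.ne n)))

/-- Since $\mathfrak m\subseteq\sqrt{(x)}$, the quotient by the nonzerodivisor $x$ has dimension
$0$, and the dimension drops by exactly one. -/
theorem ringKrullDim_eq_one : ringKrullDim (CurveRing k n) = 1 := by
  have hlt : idealX k n ≠ ⊤ := fun h =>
    y_notMem_idealX k (NeZero.ne n) (h.symm ▸ Submodule.mem_top)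
  have : Nontrivial (CurveRing k n ⧸ idealX k n) := Ideal.Quotient.nontrivial_iff.2 hlt
  have hzero : Ring.KrullDimLE 0 (CurveRing k n ⧸ idealX k n) := by
    rw [Ring.krullDimLE_zero_iff]
    intro Q hQ
    have hle : IsLocalRing.maximalIdeal (CurveRing k n) ≤
        Q.comap (Ideal.Quotient.mk (idealX k n)) := by
      refine (maximalIdeal_le_radical k n).trans
        ((Ideal.IsPrime.radical_le_iff (hQ.comap _)).2 fun a ha => ?_)
      rw [Ideal.mem_comap, Ideal.Quotient.eq_zero_iff_mem.2 ha]
      exact zero_mem _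
    have hmax : (Q.comap (Ideal.Quotient.mk (idealX k n))).IsMaximal :=
      (IsLocalRing.maximalIdeal.isMaximal _).eq_of_le (hQ.comap _).ne_top hle ▸
        IsLocalRing.maximalIdeal.isMaximal _
    rw [← Ideal.map_comap_of_surjective _ Ideal.Quotient.mk_surjective Q]
    exact Ideal.IsMaximal.map_of_surjective_of_ker_le Ideal.Quotient.mk_surjective
      (Ideal.comap_mono bot_le)
  have h0 : ringKrullDim (CurveRing k n ⧸ idealX k n) = 0 :=
    le_antisymm (Ring.krullDimLE_iff.1 hzero) ringKrullDim_nonneg_of_nontrivial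
  rw [← ringKrullDim_quotient_span_singleton_succ_eq_ringKrullDim_of_mem_nonZeroDivisors
    (x_mem_nonZeroDivisors k (NeZero.ne n)) (x_mem_maximalIdeal k n)]
  exact (congrArg (· + 1) h0).trans (zero_add 1)

theorem topLocalCohomology_eq : topLocalCohomology (CurveRing k n) =
    (localCohomology (IsLocalRing.maximalIdeal (CurveRing k n)) 1).obj
      (ModuleCat.of _ (CurveRing k n)) := by
  rw [topLocalCohomology, ringKrullDim_eq_one]
  rfl

end CurveRing

end CurveRingFacts

end

theorem mainTheorem12 {k : Type*} [Field k] [IsAlgClosed k] (n : ℕ) [NeZero n] (hodd : Odd n)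
    (hn : 1 < n) (i : ℕ) (hi : 1 ≤ i) (hin : i < n) :
    CurveRing.y k n ∈
        (CurveRing.idealI k n i * CurveRing.idealX k n).colon
          (CurveRing.idealI k n i : Set (CurveRing k n)) ∧
      CurveRing.y k n ∉ CurveRing.idealX k n ∧
      ¬ IsClRational (moduleClosure (CurveRing k n) (CurveRing.idealI k n i)) := by
  have hcolon := CurveRing.y_mem_colon k hi hin
  have hy := CurveRing.y_notMem_idealX k (NeZero.ne n)
  refine ⟨hcolon, hy, ?_⟩
  obtain ⟨t, ht⟩ := Ideal.exists_pow_le_of_le_radical_of_fg (CurveRing.maximalIdeal_le_radical k n)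
    (IsNoetherian.noetherian _)
  have hζ := exists_localCohomology_one (CurveRing.x_mem_maximalIdeal k n)
    (CurveRing.x_mem_nonZeroDivisors k (NeZero.ne n)) ht hy
  rw [← CurveRing.topLocalCohomology_eq] at hζ
  obtain ⟨ζ, hxζ, hyζ⟩ := hζ
  exact not_isClRational hyζ (smul_mem_moduleClosure_bot hcolon hxζ)
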